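/- Let $H$ be a real Hilbert space. Let $F:\operatorname{Dom}F\subset H\to H$ be a single-valued, continuous, monotone map satisfying $\|F(x)-F(y)\|\le L\|x-y\|$ for all $x,y\in\operatorname{Dom}F$, where $L>0$. Let $B:H\rightrightarrows H$ be maximal monotone with $\operatorname{Dom}B\subset C\subset\operatorname{Dom}F$, where $C$ is a nonempty closed convex subset of $H$, and assume that the solution set $S=(F+B)^{-1}(0)=\{x : 0\in F(x)+B(x)\}$ is nonempty. Let $x_0\in H$, $\sigma\in(0,1)$, $\lambda=\sigma/L$, and let $(\alpha_k)_{k\ge0}$, $(\beta_k)_{k\ge0}$ be sequences of nonnegative reals with $$\overline\alpha=\sup_{k\ge0}\alpha_k<\infty,\qquad \overline s=\sum_{k=0}^\infty\beta_k^2<\infty,\qquad \overline\beta=\sup_{k\ge0}\beta_k .$$ Write $P_A$ for the orthogonal projection onto $A$. Put $x_{-1}=x_0$ and, for $k=0,1,2,\dots$, $$w_k=x_k+\alpha_k(x_k-x_{k-1}),\qquad \widetilde w_k=w_k+\beta_k(w_k-x_0),\qquad w_k'=P_C(\widetilde w_k),$$ $$y_k=(\lambda B+I)^{-1}\bigl(\widetilde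 w_k-\lambda F(w_k')\bigr),\qquad v_k=F(y_k)-F(w_k')+\tfrac1\lambda(\widetilde w_k-y_k),$$ $$H_k=\{z:\langle z-y_k,v_k\rangle\le0\},\qquad W_k=\{z:\langle z-x_k,x_0-x_k\rangle\le0\},\qquad x_{k+1}=P_{H_k\cap W_k}(x_0).$$ Then these sequences and the projection $P_S(x_0)$ are well defined and, with $d_0$ denoting the distance from $x_0$ to $S$, the following hold. (a) The sequences $(x_k)$ and $(y_k)$ converge strongly to $P_S(x_0)$. (b) For every $k\ge0$ there exists $j\in\{0,\dots,k\}$ such that $v_j\in(F+B)(y_j)$ and $$\|v_j\|\le\frac{2d_0L}{\sqrt{k+1}}\cdot\frac{\sqrt{(1+\overline\alpha)\left[(1+\overline\beta)\bigl(1+\overline\alpha(1+\overline\beta)\bigr)+\overline s\right]}}{(1-\sigma^2)\,\sigma}.$$ -/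

import Mathlib

namespace InertialTseng

open scoped Pointwise

variable {H : Type*} [NormedAddCommGroup H] [InnerProductSpace ℝ H]

/-- A set-valued map `T : H ⇉ H` is a monotone operator. -/
def IsMonotoneOp (T : H → Set H) : Prop :=
  ∀ x y, ∀ u ∈ T x, ∀ v ∈ T y, 0 ≤ inner ℝ (x - y) (u - v)

/-- `T` is maximal monotone: it is monotone and its graph is not properly contained in the graph
of another monotone operator. -/
def IsMaximalMonotoneOp (T : H → Set H) : Prop :=
  IsMonotoneOp T ∧ ∀ T' : H → Set H, IsMonotoneOp T' → (∀ x, T x ⊆ T' x) → T' = T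

/-- The effective domain of a set-valued map. -/
def opDom (T : H → Set H) : Set H := {x | (T x).Nonempty}

/-- The inverse of a set-valued map. -/
def opInv (T : H → Set H) : H → Set H := fun x => {v | x ∈ T v}

/-- The set-valued representation of a single-valued map `F : D ⊆ H → H` (the values of `F`
outside `D` are irrelevant). -/
def ofMap (F : H → H) (D : Set H) : H → Set H := fun x => {u | x ∈ D ∧ u = F x}

/-- The Minkowski sum of two set-valued maps. -/
def opAdd (T S : H → Set H) : H → Set H := fun x => T x + S x

/-- The resolvent `(lam T + I)⁻¹`, as a set-valued map. -/
def opResolvent (lam : ℝ) (T : H → Set H) : H → Set H :=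
  opInv (opAdd (fun x => lam • T x) (fun x => {x}))

/-- The solution set `(F + B)⁻¹(0)` of the inclusion `0 ∈ F(x) + B(x)`, with `Dom F = D`. -/
def solSet (F : H → H) (D : Set H) (B : H → Set H) : Set H :=
  opInv (opAdd (ofMap F D) B) 0

/-- `p = P_C(x)`: `p` is the unique element of `C` at minimal distance from `x`. -/
def IsProj (C : Set H) (x p : H) : Prop :=
  ∀ q, (q ∈ C ∧ ∀ z ∈ C, ‖q - x‖ ≤ ‖z - x‖) ↔ q = p

/-- The sequences `x, w, wt, w', y, v` are generated by the inertial Tseng forward-backward method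
with stepsize `lam`, inertial parameters `α, β` and starting point `x0`. Here `wt` and `wp` are the
sequences written `w̃` and `w'`. The convention `x₋₁ = x₀` is built into the truncated index
`k - 1`, which is `0` for `k = 0`. -/
structure IsTsengRun (F : H → H) (B : H → Set H) (C : Set H) (lam : ℝ) (α β : ℕ → ℝ) (x0 : H)
    (x w wt wp y v : ℕ → H) : Prop where
  init : x 0 = x0
  w_eq : ∀ k, w k = x k + α k • (x k - x (k - 1))
  wt_eq : ∀ k, wt k = w k + β k • (w k - x0)
  wp_eq : ∀ k, IsProj C (wt k) (wp k)
  y_eq : ∀ k, y k ∈ opResolvent lam B (wt k - lam • F (wp k))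
  v_eq : ∀ k, v k = F (y k) - F (wp k) + (1 / lam) • (wt k - y k)
  x_succ : ∀ k, IsProj
    ({z | inner ℝ (z - y k) (v k) ≤ 0} ∩ {z | inner ℝ (z - x k) (x0 - x k) ≤ 0}) x0 (x (k + 1))

end InertialTseng

open InertialTseng

namespace InertialTseng

open scoped Pointwise Topology
open Filter

variable {H : Type*} [NormedAddCommGroup H] [InnerProductSpace ℝ H]

/-! Write S for the solution set, d for the distance from `x0` to S, and e_k = `wt k - x (k+1)`.
Since `v k` lies in (F+B)(`y k`), monotonicity puts S inside H_k; the variational inequality of the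
projection then puts S inside every W_k by induction. So the iterates exist, stay within d of `x0`,
and have square-summable steps (`IsTsengRun.sum_norm_sq_le`).

Membership of `x (k+1)` in W_k makes one cross term in ‖e_k‖² nonpositive, so Σ‖e_k‖² is at most d²
times an explicit constant (`IsTsengRun.sum_norm_sub_succ_sq_le`). Membership in H_k, with the
relative-error estimate of the forward-backward-forward step, bounds both `v k` and `wt k - y k` by
multiples of ‖e_k‖ (`IsTsengRun.residual_le`). Averaging the squares gives the rate in (b).

For (a), `v k` and `y k - x k` tend to 0, so weak limits of `x` solve the inclusion
(`weak_limit_mem_solSet`). As `x` stays in the ball of radius d about `x0`, the only possible weak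
limit is the projection, and the norm bound makes the convergence strong.

Existence of resolvents is Minty's theorem, proved by minimizing the Fitzpatrick function plus half
the squared norm. -/

/-! ### Maximal monotone operators and Minty's theorem. -/

/-- A point monotonically related to the graph of a maximal monotone operator lies in it. -/
theorem IsMaximalMonotoneOp.mem {T : H → Set H} (hT : IsMaximalMonotoneOp T) {x u : H}
    (h : ∀ z, ∀ v ∈ T z, 0 ≤ inner ℝ (x - z) (u - v)) : u ∈ T x := by
  have key := hT.2 (fun z => T z ∪ {v | z = x ∧ v = u}) ?_ (fun z => Set.subset_union_left)
  · rw [← key]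
    exact Or.inr ⟨rfl, rfl⟩
  · rintro a b p (hp | ⟨rfl, rfl⟩) q (hq | ⟨rfl, rfl⟩)
    · exact hT.1 a b p hp q hq
    · have := h a p hp
      rwa [← neg_sub a b, ← neg_sub p q, inner_neg_neg] at this
    · exact h b q hq
    · simp

/-- Existence of a minimizer of `t + ‖q‖² / 2` over a closed convex set on which it is bounded
below. -/
theorem exists_min_add_norm_sq {E : Type*} [NormedAddCommGroup E] [InnerProductSpace ℝ E]
    [CompleteSpace E] {K : Set (E × ℝ)} (hne : K.Nonempty) (hcl : IsClosed K)
    (hconv : Convex ℝ K) (hbdd : ∀ q ∈ K, 0 ≤ q.2 + ‖q.1‖ ^ 2 / 2) :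
    ∃ p ∈ K, ∀ q ∈ K, p.2 + ‖p.1‖ ^ 2 / 2 ≤ q.2 + ‖q.1‖ ^ 2 / 2 := by
  set g : E × ℝ → ℝ := fun q => q.2 + ‖q.1‖ ^ 2 / 2 with hg
  set m := sInf (g '' K) with hm
  have hbb : BddBelow (g '' K) := ⟨0, by rintro _ ⟨q, hq, rfl⟩; exact hbdd q hq⟩
  have hle : ∀ q ∈ K, m ≤ g q := fun q hq => csInf_le hbb ⟨q, hq, rfl⟩
  have hex : ∀ n : ℕ, ∃ q ∈ K, g q < m + 1 / ((n : ℝ) + 1) := fun n => by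
    obtain ⟨_, ⟨q, hq, rfl⟩, h⟩ := exists_lt_of_csInf_lt (hne.image g)
      (lt_add_of_pos_right m (Nat.one_div_pos_of_nat (n := n) (α := ℝ)))
    exact ⟨q, hq, h⟩
  choose q hqK hq using hex
  -- Parallelogram law at midpoints: the minimizing sequence is Cauchy in its first component. The
  -- second component then converges because the values do.
  have hdist : ∀ i j, ‖(q i).1 - (q j).1‖ ^ 2 ≤ 4 * (1 / ((i : ℝ) + 1) + 1 / ((j : ℝ) + 1)) := by
    intro i j
    have hmid := hle _ (hconv (hqK i) (hqK j) (a := 1 / 2) (b := 1 / 2)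
      (by norm_num) (by norm_num) (by norm_num))
    have e : ‖(1 / 2 : ℝ) • (q i).1 + (1 / 2 : ℝ) • (q j).1‖ ^ 2
        = ‖(q i).1‖ ^ 2 / 2 + ‖(q j).1‖ ^ 2 / 2 - ‖(q i).1 - (q j).1‖ ^ 2 / 4 := by
      rw [← smul_add, norm_smul, mul_pow, norm_add_sq_real, norm_sub_sq_real]
      norm_num
      ring
    have hi := hq i
    have hj := hq j
    simp only [hg, Prod.fst_add, Prod.snd_add, Prod.smul_fst, Prod.smul_snd, smul_eq_mul]
      at hmid hi hj
    rw [e] at hmid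
    linarith
  have hcau : CauchySeq fun n => (q n).1 := by
    rw [Metric.cauchySeq_iff]
    intro ε hε
    obtain ⟨N, hN⟩ := exists_nat_one_div_lt (show (0 : ℝ) < ε ^ 2 / 8 by positivity)
    refine ⟨N, fun i hi j hj => ?_⟩
    rw [dist_eq_norm]
    have h1 := Nat.one_div_le_one_div (α := ℝ) hi
    have h2 := Nat.one_div_le_one_div (α := ℝ) hj
    refine lt_of_pow_lt_pow_left₀ 2 hε.le ?_
    linarith [hdist i j]
  obtain ⟨p, hp⟩ := cauchySeq_tendsto_of_complete hcau
  have hgm : Tendsto (fun n => g (q n)) atTop (𝓝 m) := by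
    refine tendsto_of_tendsto_of_tendsto_of_le_of_le tendsto_const_nhds ?_
      (fun n => hle _ (hqK n)) (fun n => (hq n).le)
    simpa using tendsto_one_div_add_atTop_nhds_zero_nat.const_add m
  have hp2 : Tendsto (fun n => (q n).2) atTop (𝓝 (m - ‖p‖ ^ 2 / 2)) := by
    have := hgm.sub ((hp.norm.pow 2).div_const 2)
    simpa [hg] using this
  refine ⟨(p, m - ‖p‖ ^ 2 / 2), hcl.mem_of_tendsto (hp.prodMk_nhds hp2)
    (Eventually.of_forall hqK), fun r hr => ?_⟩
  simpa using hle r hr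

/-- Minty's theorem, in the form: a nonempty maximal monotone graph meets the antidiagonal. -/
theorem exists_neg_mem_of_maximal [CompleteSpace H] {T : H → Set H} (hmono : IsMonotoneOp T)
    (hmax : ∀ x u, (∀ z, ∀ v ∈ T z, 0 ≤ inner ℝ (x - z) (u - v)) → u ∈ T x)
    (hne : ∃ x u, u ∈ T x) : ∃ x, -x ∈ T x := by
  -- The epigraph of the Fitzpatrick function of `T`.
  let K : Set (WithLp 2 (H × H) × ℝ) := {q | ∀ z, ∀ v ∈ T z,
    inner ℝ q.1.fst v + inner ℝ z q.1.snd - inner ℝ z v ≤ q.2}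
  have hcl : IsClosed K := by
    simp only [K, Set.ofPred_forall]
    refine isClosed_iInter fun z => isClosed_iInter fun v => isClosed_iInter fun _ => ?_
    have h1 : Continuous fun q : WithLp 2 (H × H) × ℝ => q.1.fst :=
      (WithLp.continuous_fst 2 H H).comp continuous_fst
    have h2 : Continuous fun q : WithLp 2 (H × H) × ℝ => q.1.snd :=
      (WithLp.continuous_snd 2 H H).comp continuous_fst
    exact isClosed_le (((h1.inner continuous_const).add
      (continuous_const.inner h2)).sub continuous_const) continuous_snd
  have hconv : Convex ℝ K := by
    intro q hq r hr a b ha hb hab z v hv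
    have h1 := mul_le_mul_of_nonneg_left (hq z v hv) ha
    have h2 := mul_le_mul_of_nonneg_left (hr z v hv) hb
    simp only [Prod.fst_add, Prod.snd_add, Prod.smul_fst, Prod.smul_snd, smul_eq_mul,
      WithLp.add_fst, WithLp.add_snd, WithLp.smul_fst, WithLp.smul_snd, inner_add_left,
      inner_add_right, real_inner_smul_left, real_inner_smul_right]
    have h3 : inner ℝ z v = (a + b) * inner ℝ z v := by rw [hab, one_mul]
    rw [h3]
    linarith
  have hgraph : ∀ x, ∀ u ∈ T x, (WithLp.toLp 2 (x, u), inner ℝ x u) ∈ K := by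
    intro x u hu z v hv
    have := hmono x z u hu v hv
    simp only [inner_sub_left, inner_sub_right] at this
    change inner ℝ x v + inner ℝ z u - inner ℝ z v ≤ inner ℝ x u
    linarith
  -- The Fitzpatrick function dominates the duality pairing: where it were smaller, the point would
  -- be monotonically related to the graph, hence on it, where the two agree.
  have hlow : ∀ q ∈ K, inner ℝ q.1.fst q.1.snd ≤ q.2 := by
    intro q hq
    by_contra! hlt
    have hmem : q.1.snd ∈ T q.1.fst := hmax _ _ fun z v hv => by
      have := hq z v hv
      simp only [inner_sub_left, inner_sub_right]
      linarith
    have := hq _ _ hmem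
    linarith
  have hnorm : ∀ q : WithLp 2 (H × H), ‖q‖ ^ 2 = ‖q.fst‖ ^ 2 + ‖q.snd‖ ^ 2 :=
    fun q => WithLp.prod_norm_sq_eq_of_L2 q
  obtain ⟨x₁, u₁, hu₁⟩ := hne
  obtain ⟨p, hpK, hp⟩ := exists_min_add_norm_sq (K := K) ⟨_, hgraph x₁ u₁ hu₁⟩ hcl hconv
    (fun q hq => by
      have h1 := hlow q hq
      have h2 := norm_add_sq_real q.1.fst q.1.snd
      rw [hnorm]
      nlinarith [sq_nonneg ‖q.1.fst + q.1.snd‖])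
  -- First-order optimality at the minimizer `p`, read along the segment from `p` to `q`.
  have hfirst : ∀ q ∈ K, 0 ≤ q.2 - p.2 + inner ℝ p.1 (q.1 - p.1) := by
    intro q hq
    by_contra! hlt
    set D := q.2 - p.2 + inner ℝ p.1 (q.1 - p.1) with hD
    set N := ‖q.1 - p.1‖ ^ 2 with hN
    have hN0 : 0 ≤ N := by positivity
    have hstep : ∀ s : ℝ, 0 ≤ s → s ≤ 1 → 0 ≤ s * D + s ^ 2 * N / 2 := by
      intro s hs0 hs1
      have := hp _ (hconv.add_smul_sub_mem hpK hq ⟨hs0, hs1⟩)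
      simp only [Prod.fst_add, Prod.snd_add, Prod.smul_fst, Prod.smul_snd, Prod.fst_sub,
        Prod.snd_sub, smul_eq_mul] at this
      rw [norm_add_sq_real, real_inner_smul_right, norm_smul, mul_pow, Real.norm_eq_abs,
        sq_abs, ← hN] at this
      rw [hD]
      linarith
    -- The parabola s·D + s²·N/2 has its vertex at -D/N. Enlarging the denominator to N - D keeps s
    -- in (0, 1] and covers N = 0, while the value stays negative.
    have hs : 0 < -D / (N - D) := div_pos (by linarith) (by linarith)
    have hs1 : -D / (N - D) ≤ 1 := by rw [div_le_one (by linarith)]; linarith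
    have h := hstep _ hs.le hs1
    have hsN : -D / (N - D) * N ≤ -D := by
      rw [div_mul_eq_mul_div, div_le_iff₀ (by linarith)]
      nlinarith
    nlinarith
  have hkey : ∀ z, ∀ v ∈ T z,
      ‖p.1.fst + p.1.snd‖ ^ 2 ≤ inner ℝ (-p.1.snd - z) (-p.1.fst - v) := by
    intro z v hv
    have h := hfirst _ (hgraph z v hv)
    have h2 := hlow p hpK
    rw [WithLp.prod_inner_apply] at h
    change 0 ≤ inner ℝ z v - p.2 + (inner ℝ p.1.fst (z - p.1.fst) + inner ℝ p.1.snd (v - p.1.snd))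
      at h
    simp only [inner_sub_left, inner_sub_right, inner_neg_left, inner_neg_right,
      norm_add_sq_real, real_inner_self_eq_norm_sq] at h ⊢
    have h4 : inner ℝ p.1.snd p.1.fst = inner ℝ p.1.fst p.1.snd := real_inner_comm _ _
    have h3 : inner ℝ p.1.fst z = inner ℝ z p.1.fst := real_inner_comm _ _
    linarith
  -- The swapped and negated minimizer is on the graph; testing `hkey` on that very point forces its
  -- two coordinates to be opposite.
  have hmem := hmax (-p.1.snd) (-p.1.fst) fun z v hv => (sq_nonneg _).trans (hkey z v hv)
  have hz := hkey _ _ hmem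
  simp only [sub_self, inner_zero_left] at hz
  have h0 : p.1.fst + p.1.snd = 0 := by
    have : ‖p.1.fst + p.1.snd‖ = 0 := by nlinarith [norm_nonneg (p.1.fst + p.1.snd)]
    exact norm_eq_zero.mp this
  refine ⟨p.1.fst, ?_⟩
  rwa [neg_eq_of_add_eq_zero_left h0] at hmem

theorem mem_opResolvent {lam : ℝ} (hlam : lam ≠ 0) {T : H → Set H} {w y : H} :
    y ∈ opResolvent lam T w ↔ (1 / lam) • (w - y) ∈ T y := by
  simp only [opResolvent, opInv, opAdd, Set.mem_ofPred_eq, Set.add_singleton,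
    Set.image_add_right, Set.mem_preimage]
  rw [Set.mem_smul_set_iff_inv_smul_mem₀ hlam, one_div, sub_eq_add_neg]

/-- Minty's theorem: the resolvent of a maximal monotone operator has full domain. -/
theorem IsMaximalMonotoneOp.exists_mem_opResolvent [CompleteSpace H] {T : H → Set H}
    (hT : IsMaximalMonotoneOp T) (hne : ∃ x u, u ∈ T x) {lam : ℝ} (hlam : 0 < lam) (w : H) :
    ∃ y, y ∈ opResolvent lam T w := by
  -- The operator lam • T - w: meeting the antidiagonal at x means (w - x)/lam ∈ T x.
  obtain ⟨x, hx⟩ := exists_neg_mem_of_maximal (T := fun x => {u | (1 / lam) • (u + w) ∈ T x})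
    (fun x y u hu v hv => by
      have := hT.1 x y _ hu _ hv
      rw [← smul_sub, real_inner_smul_right, add_sub_add_right_eq_sub] at this
      exact nonneg_of_mul_nonneg_right this (by positivity))
    (fun x u h => hT.mem fun z v hv => by
      have h1 := h z (lam • v - w) (by
        simp only [Set.mem_ofPred_eq, sub_add_cancel, smul_smul]
        rwa [one_div_mul_cancel hlam.ne', one_smul])
      have h2 : (1 / lam) • (u + w) - v = (1 / lam) • (u - (lam • v - w)) := by
        rw [smul_sub, smul_sub, smul_smul, one_div_mul_cancel hlam.ne', one_smul, smul_add]
        abel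
      rw [h2, real_inner_smul_right]
      positivity)
    (by
      obtain ⟨x, u, hu⟩ := hne
      refine ⟨x, lam • u - w, ?_⟩
      simp only [Set.mem_ofPred_eq, sub_add_cancel, smul_smul]
      rwa [one_div_mul_cancel hlam.ne', one_smul])
  refine ⟨x, (mem_opResolvent hlam.ne').2 ?_⟩
  rwa [sub_eq_add_neg, add_comm]

/-- Monotonicity gives ‖y₁ - y₂‖² ≤ ⟨y₁ - y₂, w₁ - w₂⟩; Cauchy–Schwarz finishes. -/
theorem IsMonotoneOp.dist_opResolvent_le {T : H → Set H} (hT : IsMonotoneOp T) {lam : ℝ}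
    (hlam : 0 < lam) {w₁ w₂ y₁ y₂ : H} (h₁ : y₁ ∈ opResolvent lam T w₁)
    (h₂ : y₂ ∈ opResolvent lam T w₂) : ‖y₁ - y₂‖ ≤ ‖w₁ - w₂‖ := by
  have h := hT _ _ _ ((mem_opResolvent hlam.ne').1 h₁) _ ((mem_opResolvent hlam.ne').1 h₂)
  rw [← smul_sub, real_inner_smul_right] at h
  have h' := nonneg_of_mul_nonneg_right h (by positivity)
  have e : w₁ - y₁ - (w₂ - y₂) = (w₁ - w₂) - (y₁ - y₂) := by abel
  rw [e, inner_sub_right, real_inner_self_eq_norm_sq] at h'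
  have h2 := real_inner_le_norm (y₁ - y₂) (w₁ - w₂)
  by_contra! hlt
  nlinarith [norm_nonneg (w₁ - w₂)]

/-! ### Projections and half-spaces. -/

theorem IsProj.mem {H : Type*} [NormedAddCommGroup H] {C : Set H} {x p : H}
    (h : IsProj C x p) : p ∈ C := ((h p).2 rfl).1

theorem IsProj.norm_le {H : Type*} [NormedAddCommGroup H] {C : Set H} {x p z : H}
    (h : IsProj C x p) (hz : z ∈ C) : ‖p - x‖ ≤ ‖z - x‖ := ((h p).2 rfl).2 z hz

theorem IsProj.inner_le {C : Set H} (hC : Convex ℝ C) {x p z : H} (h : IsProj C x p)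
    (hz : z ∈ C) : inner ℝ (z - p) (x - p) ≤ 0 := by
  have : Nonempty C := ⟨⟨p, h.mem⟩⟩
  rw [real_inner_comm]
  refine (norm_eq_iInf_iff_real_inner_le_zero hC h.mem).1 (le_antisymm ?_ ?_) z hz
  · refine le_ciInf fun w => ?_
    rw [norm_sub_rev x, norm_sub_rev x]
    exact h.norm_le w.2
  · exact ciInf_le (f := fun w : C => ‖x - w‖) ⟨0, by rintro _ ⟨w, rfl⟩; positivity⟩ ⟨p, h.mem⟩

/-- The obtuse angle at `p` gives ‖p - x‖² + ‖z - p‖² ≤ ‖z - x‖², which yields both the minimality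
and the uniqueness that `IsProj` demands. -/
theorem isProj_of_inner_le {C : Set H} {x p : H} (hp : p ∈ C)
    (h : ∀ z ∈ C, inner ℝ (z - p) (x - p) ≤ 0) : IsProj C x p := by
  have key : ∀ z ∈ C, ‖p - x‖ ^ 2 + ‖z - p‖ ^ 2 ≤ ‖z - x‖ ^ 2 := fun z hz => by
    have e : z - x = (z - p) - (x - p) := by abel
    rw [e, norm_sub_sq_real (z - p), norm_sub_rev p x]
    linarith [h z hz]
  refine fun q => ⟨fun ⟨hq, hmin⟩ => ?_, ?_⟩
  · have h1 := pow_le_pow_left₀ (norm_nonneg _) (hmin p hp) 2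
    have h2 : ‖q - p‖ ^ 2 ≤ 0 := by linarith [key q hq]
    have h3 : ‖q - p‖ = 0 := by nlinarith [norm_nonneg (q - p)]
    exact sub_eq_zero.1 (norm_eq_zero.1 h3)
  · rintro rfl
    refine ⟨hp, fun z hz => ?_⟩
    refine le_of_sq_le_sq ?_ (norm_nonneg _)
    nlinarith [key z hz, sq_nonneg ‖z - q‖]

theorem exists_isProj [CompleteSpace H] {C : Set H} (hne : C.Nonempty) (hcl : IsClosed C)
    (hconv : Convex ℝ C) (x : H) : ∃ p, IsProj C x p := by
  obtain ⟨p, hp, h⟩ := exists_norm_eq_iInf_of_complete_convex hne hcl.isComplete hconv x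
  refine ⟨p, isProj_of_inner_le hp fun z hz => ?_⟩
  rw [real_inner_comm]
  exact (norm_eq_iInf_iff_real_inner_le_zero hconv hp).1 h z hz

theorem IsProj.infDist_eq {H : Type*} [NormedAddCommGroup H] {C : Set H} {x p : H}
    (h : IsProj C x p) : Metric.infDist x C = ‖p - x‖ := by
  refine le_antisymm ?_ ?_
  · rw [← dist_eq_norm, dist_comm]
    exact Metric.infDist_le_dist_of_mem h.mem
  · refine (Metric.le_infDist ⟨p, h.mem⟩).2 fun z hz => ?_
    rw [dist_comm, dist_eq_norm]
    exact h.norm_le hz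

theorem isClosed_setOf_inner_sub_le (a b : H) : IsClosed {z : H | inner ℝ (z - a) b ≤ 0} :=
  isClosed_le ((continuous_id.sub continuous_const).inner continuous_const) continuous_const

theorem convex_setOf_inner_sub_le (a b : H) : Convex ℝ {z : H | inner ℝ (z - a) b ≤ 0} := by
  intro p hp q hq s t hs ht hst
  have e : s • p + t • q - a = s • (p - a) + t • (q - a) := by
    have : a = (s + t) • a := by rw [hst, one_smul]
    nth_rw 1 [this]
    rw [add_smul, smul_sub, smul_sub]
    abel
  simp only [Set.mem_ofPred_eq] at hp hq ⊢
  rw [e, inner_add_left, real_inner_smul_left, real_inner_smul_left]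
  nlinarith

/-! ### The operator F + B and its solution set. -/

theorem mem_opAdd_ofMap {H : Type*} [NormedAddCommGroup H] {F : H → H} {D : Set H}
    {B : H → Set H} {y v : H} :
    v ∈ opAdd (ofMap F D) B y ↔ y ∈ D ∧ v - F y ∈ B y := by
  simp only [opAdd, ofMap, Set.mem_add, Set.mem_ofPred_eq]
  constructor
  · rintro ⟨_, ⟨hy, rfl⟩, b, hb, rfl⟩
    exact ⟨hy, by simpa using hb⟩
  · rintro ⟨hy, hb⟩
    exact ⟨F y, ⟨hy, rfl⟩, _, hb, by abel⟩

theorem isMonotoneOp_opAdd_ofMap {F : H → H} {D : Set H} {B : H → Set H}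
    (hF : ∀ x ∈ D, ∀ y ∈ D, 0 ≤ inner ℝ (x - y) (F x - F y)) (hB : IsMonotoneOp B) :
    IsMonotoneOp (opAdd (ofMap F D) B) := by
  intro x y u hu v hv
  obtain ⟨hx, hu⟩ := mem_opAdd_ofMap.1 hu
  obtain ⟨hy, hv⟩ := mem_opAdd_ofMap.1 hv
  have e : u - v = (F x - F y) + ((u - F x) - (v - F y)) := by abel
  rw [e, inner_add_right]
  exact add_nonneg (hF x hx y hy) (hB _ _ _ hu _ hv)

/-- The resolvent of `F + B` has full domain, for a small stepsize. -/
theorem exists_mem_opAdd_ofMap [CompleteSpace H] {F : H → H} {D C : Set H} {B : H → Set H}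
    {L : ℝ} (hL : 0 < L) (hFlip : ∀ x ∈ D, ∀ y ∈ D, ‖F x - F y‖ ≤ L * ‖x - y‖)
    (hB : IsMaximalMonotoneOp B) (hCcl : IsClosed C) (hBC : opDom B ⊆ C) (hCD : C ⊆ D)
    (hne : ∃ x u, u ∈ B x) (w : H) :
    ∃ z, (2 * L) • (w - z) ∈ opAdd (ofMap F D) B z := by
  have hmu : 0 < 1 / (2 * L) := by positivity
  choose J hJ using fun w => hB.exists_mem_opResolvent hne hmu w
  have hJC : ∀ w, J w ∈ C := fun w => hBC ⟨_, (mem_opResolvent hmu.ne').1 (hJ w)⟩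
  obtain ⟨x₁, u₁, hu₁⟩ := hne
  have : Nonempty C := ⟨⟨x₁, hBC ⟨u₁, hu₁⟩⟩⟩
  have : CompleteSpace C := hCcl.completeSpace_coe
  -- A forward-backward map with stepsize 1/(2L): it maps C into itself since resolvents land in Dom
  -- B ⊆ C, and it contracts by 1/2. Its fixed point is the required z.
  let G : C → C := fun z => ⟨J (w - (1 / (2 * L)) • F z), hJC _⟩
  have hG : ContractingWith (1 / 2) G := by
    refine ⟨by norm_num, LipschitzWith.of_dist_le_mul fun a b => ?_⟩
    rw [Subtype.dist_eq, Subtype.dist_eq, dist_eq_norm, dist_eq_norm]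
    refine (hB.1.dist_opResolvent_le hmu (hJ _) (hJ _)).trans ?_
    rw [sub_sub_sub_cancel_left, ← smul_sub, norm_smul, Real.norm_of_nonneg hmu.le,
      norm_sub_rev]
    refine (mul_le_mul_of_nonneg_left (hFlip _ (hCD a.2) _ (hCD b.2)) hmu.le).trans (le_of_eq ?_)
    push_cast
    field_simp
  obtain ⟨z, hz⟩ : ∃ z : C, G z = z := ⟨_, hG.fixedPoint_isFixedPt⟩
  refine ⟨z, mem_opAdd_ofMap.2 ⟨hCD z.2, ?_⟩⟩
  have h := (mem_opResolvent hmu.ne').1 (hJ (w - (1 / (2 * L)) • F z))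
  have hz' : J (w - (1 / (2 * L)) • F z) = z := congrArg Subtype.val hz
  rw [hz', one_div_one_div] at h
  convert h using 1
  rw [sub_right_comm, smul_sub (2 * L) (w - (z : H)), smul_smul, mul_one_div_cancel (by positivity),
    one_smul]

theorem mem_solSet {H : Type*} [NormedAddCommGroup H] {F : H → H} {D : Set H}
    {B : H → Set H} {y : H} :
    y ∈ solSet F D B ↔ (0 : H) ∈ opAdd (ofMap F D) B y := Iff.rfl

/-- Minty's description of the solution set as an intersection of half-spaces. -/
theorem mem_solSet_iff [CompleteSpace H] {F : H → H} {D C : Set H} {B : H → Set H} {L : ℝ}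
    (hFmono : ∀ x ∈ D, ∀ y ∈ D, 0 ≤ inner ℝ (x - y) (F x - F y))
    (hL : 0 < L) (hFlip : ∀ x ∈ D, ∀ y ∈ D, ‖F x - F y‖ ≤ L * ‖x - y‖)
    (hB : IsMaximalMonotoneOp B) (hCcl : IsClosed C) (hBC : opDom B ⊆ C) (hCD : C ⊆ D)
    (hne : ∃ x u, u ∈ B x) {y : H} :
    y ∈ solSet F D B ↔ ∀ z, ∀ u ∈ opAdd (ofMap F D) B z, inner ℝ (y - z) u ≤ 0 := by
  constructor
  · intro hy z u hu
    have := isMonotoneOp_opAdd_ofMap hFmono hB.1 _ _ _ (mem_solSet.1 hy) _ hu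
    rw [zero_sub, inner_neg_right] at this
    linarith
  · intro h
    -- Testing `h` against the resolvent point z of y itself gives 2L‖y - z‖² ≤ 0, so y = z.
    obtain ⟨z, hz⟩ := exists_mem_opAdd_ofMap hL hFlip hB hCcl hBC hCD hne y
    have h1 := h z _ hz
    rw [real_inner_smul_right, real_inner_self_eq_norm_sq] at h1
    have h2 : ‖y - z‖ ^ 2 ≤ 0 := nonpos_of_mul_nonpos_right h1 (by positivity)
    have h3 : ‖y - z‖ = 0 := by nlinarith [norm_nonneg (y - z)]
    have h4 : y - z = 0 := norm_eq_zero.1 h3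
    rw [h4, smul_zero] at hz
    rw [sub_eq_zero.1 h4]
    exact hz

theorem isClosed_and_convex_solSet [CompleteSpace H] {F : H → H} {D C : Set H} {B : H → Set H}
    {L : ℝ} (hFmono : ∀ x ∈ D, ∀ y ∈ D, 0 ≤ inner ℝ (x - y) (F x - F y))
    (hL : 0 < L) (hFlip : ∀ x ∈ D, ∀ y ∈ D, ‖F x - F y‖ ≤ L * ‖x - y‖)
    (hB : IsMaximalMonotoneOp B) (hCcl : IsClosed C) (hBC : opDom B ⊆ C) (hCD : C ⊆ D)
    (hne : ∃ x u, u ∈ B x) : IsClosed (solSet F D B) ∧ Convex ℝ (solSet F D B) := by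
  have e : solSet F D B = ⋂ (z) (u) (_ : u ∈ opAdd (ofMap F D) B z),
      {y | inner ℝ (y - z) u ≤ 0} := by
    ext y
    rw [mem_solSet_iff hFmono hL hFlip hB hCcl hBC hCD hne]
    simp
  rw [e]
  exact ⟨isClosed_iInter fun z => isClosed_iInter fun u => isClosed_iInter fun _ =>
      isClosed_setOf_inner_sub_le z u,
    convex_iInter fun z => convex_iInter fun u => convex_iInter fun _ =>
      convex_setOf_inner_sub_le z u⟩

/-! ### One step of the method, and existence of the iterates. -/

/-- The residual computed by a forward-backward-forward step belongs to `(F + B)(y)`. -/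
theorem residual_mem_opAdd {F : H → H} {D C : Set H} {B : H → Set H} (hBC : opDom B ⊆ C)
    (hCD : C ⊆ D) {lam : ℝ} (hlam : 0 < lam) {wt wp y v : H}
    (hy : y ∈ opResolvent lam B (wt - lam • F wp))
    (hv : v = F y - F wp + (1 / lam) • (wt - y)) : y ∈ C ∧ v ∈ opAdd (ofMap F D) B y := by
  have h := (mem_opResolvent hlam.ne').1 hy
  have hyC : y ∈ C := hBC ⟨_, h⟩
  refine ⟨hyC, mem_opAdd_ofMap.2 ⟨hCD hyC, ?_⟩⟩
  convert h using 1
  rw [hv, sub_right_comm, smul_sub (1 / lam) (wt - y), smul_smul, one_div_mul_cancel hlam.ne',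
    one_smul]
  abel

/-- Relative-error estimate for a forward-backward-forward step. -/
theorem residual_estimate {F : H → H} {D C : Set H} {B : H → Set H} {L σ : ℝ}
    (hL : 0 < L) (hFlip : ∀ x ∈ D, ∀ y ∈ D, ‖F x - F y‖ ≤ L * ‖x - y‖) (hCconv : Convex ℝ C)
    (hBC : opDom B ⊆ C) (hCD : C ⊆ D) (hσ : 0 < σ) {wt wp y v : H} (hwp : IsProj C wt wp)
    (hy : y ∈ opResolvent (σ / L) B (wt - (σ / L) • F wp))
    (hv : v = F y - F wp + (1 / (σ / L)) • (wt - y)) :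
    (σ / L) ^ 2 * ‖v‖ ^ 2 + (1 - σ ^ 2) * ‖wt - y‖ ^ 2
      ≤ 2 * (σ / L) * inner ℝ (wt - y) v := by
  have hlam : 0 < σ / L := by positivity
  have hyC := (residual_mem_opAdd hBC hCD hlam hy hv).1
  -- Since y ∈ C, replacing `wt` by its projection only brings it closer to y; thus F is evaluated
  -- inside its domain at no cost in the Lipschitz estimate.
  have h1 : ‖y - wp‖ ^ 2 ≤ ‖wt - y‖ ^ 2 := by
    have e : wt - y = (wt - wp) - (y - wp) := by abel
    rw [e, norm_sub_sq_real (wt - wp), real_inner_comm]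
    nlinarith [hwp.inner_le hCconv hyC, sq_nonneg ‖wt - wp‖]
  have h2 : ‖(σ / L) • v - (wt - y)‖ ^ 2 ≤ σ ^ 2 * ‖wt - y‖ ^ 2 := by
    have e : (σ / L) • v - (wt - y) = (σ / L) • (F y - F wp) := by
      rw [hv, smul_add, smul_smul, mul_one_div_cancel hlam.ne', one_smul, add_sub_cancel_right]
    rw [e, norm_smul, Real.norm_of_nonneg hlam.le]
    have h3 := mul_le_mul_of_nonneg_left (hFlip y (hCD hyC) wp (hCD hwp.mem)) hlam.le
    have h4 : σ / L * (L * ‖y - wp‖) = σ * ‖y - wp‖ := by field_simp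
    rw [h4] at h3
    calc _ ≤ (σ * ‖y - wp‖) ^ 2 := pow_le_pow_left₀ (by positivity) h3 2
      _ = σ ^ 2 * ‖y - wp‖ ^ 2 := by ring
      _ ≤ _ := by gcongr
  rw [norm_sub_sq_real, norm_smul, Real.norm_of_nonneg hlam.le, real_inner_smul_left,
    real_inner_comm] at h2
  nlinarith

/-- The separating half-spaces of the method contain the solution set. -/
theorem inner_sub_residual_le_zero {F : H → H} {D : Set H} {B : H → Set H}
    (hF : ∀ x ∈ D, ∀ y ∈ D, 0 ≤ inner ℝ (x - y) (F x - F y)) (hB : IsMonotoneOp B)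
    {z y v : H} (hz : z ∈ solSet F D B) (hv : v ∈ opAdd (ofMap F D) B y) :
    inner ℝ (z - y) v ≤ 0 := by
  have := isMonotoneOp_opAdd_ofMap hF hB _ _ _ (mem_solSet.1 hz) _ hv
  rw [zero_sub, inner_neg_right] at this
  linarith

/-- The method is well defined. -/
theorem exists_isTsengRun [CompleteSpace H] {F : H → H} {D C : Set H} {B : H → Set H} {lam : ℝ}
    (hFmono : ∀ x ∈ D, ∀ y ∈ D, 0 ≤ inner ℝ (x - y) (F x - F y))
    (hB : IsMaximalMonotoneOp B) (hCne : C.Nonempty) (hCcl : IsClosed C) (hCconv : Convex ℝ C)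
    (hBC : opDom B ⊆ C) (hCD : C ⊆ D) (hne : ∃ x u, u ∈ B x) (hS : (solSet F D B).Nonempty)
    (hlam : 0 < lam) (α β : ℕ → ℝ) (x0 : H) :
    ∃ x w wt wp y v : ℕ → H, IsTsengRun F B C lam α β x0 x w wt wp y v := by
  choose P hP using fun w => exists_isProj hCne hCcl hCconv w
  choose J hJ using fun w => hB.exists_mem_opResolvent hne hlam w
  let w : ℕ → H × H → H := fun k s => s.2 + α k • (s.2 - s.1)
  let wt : ℕ → H × H → H := fun k s => w k s + β k • (w k s - x0)
  let y : ℕ → H × H → H := fun k s => J (wt k s - lam • F (P (wt k s)))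
  let v : ℕ → H × H → H := fun k s =>
    F (y k s) - F (P (wt k s)) + (1 / lam) • (wt k s - y k s)
  let Q : ℕ → H × H → Set H := fun k s =>
    {z | inner ℝ (z - y k s) (v k s) ≤ 0} ∩ {z | inner ℝ (z - s.2) (x0 - s.2) ≤ 0}
  -- The state is the pair (previous, current) iterate. The next projection exists only if S lies in
  -- the current half-space, known only by induction along the sequence; hence the unconditional
  -- choice here, justified afterwards by `hproj` and `hW`.
  let s : ℕ → H × H := fun n => Nat.rec (x0, x0)
    (fun k s => (s.2, Classical.epsilon fun p => IsProj (Q k s) x0 p)) n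
  have hs1 : ∀ k, (s k).1 = (s (k - 1)).2 := fun k => by cases k <;> rfl
  have hQconv : ∀ k t, Convex ℝ (Q k t) := fun k t =>
    (convex_setOf_inner_sub_le _ _).inter (convex_setOf_inner_sub_le _ _)
  have hQ : ∀ k t, solSet F D B ⊆ {z | inner ℝ (z - t.2) (x0 - t.2) ≤ 0} →
      solSet F D B ⊆ Q k t := fun k t h z hz =>
    ⟨inner_sub_residual_le_zero hFmono hB.1 hz
      (residual_mem_opAdd hBC hCD hlam (hJ _) rfl).2, h hz⟩
  have hproj : ∀ k, solSet F D B ⊆ {z | inner ℝ (z - (s k).2) (x0 - (s k).2) ≤ 0} →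
      IsProj (Q k (s k)) x0 (s (k + 1)).2 := fun k h =>
    Classical.epsilon_spec (exists_isProj (hS.mono (hQ k _ h))
      ((isClosed_setOf_inner_sub_le _ _).inter (isClosed_setOf_inner_sub_le _ _)) (hQconv k _) x0)
  have hW : ∀ k, solSet F D B ⊆ {z | inner ℝ (z - (s k).2) (x0 - (s k).2) ≤ 0} := by
    intro k
    induction k with
    | zero => intro z _; simp [s]
    | succ k ih => exact fun z hz => (hproj k ih).inner_le (hQconv k _) (hQ k _ ih hz)
  refine ⟨fun k => (s k).2, fun k => w k (s k), fun k => wt k (s k), fun k => P (wt k (s k)),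
    fun k => y k (s k), fun k => v k (s k), ⟨rfl, fun k => ?_, fun k => rfl, fun k => hP _,
      fun k => hJ _, fun k => rfl, fun k => hproj k (hW k)⟩⟩
  simp only [w, hs1]

/-! ### Inertial inequality and weak limits. -/

/-- The elementary norm inequality behind the summability of the inertial steps. -/
theorem norm_inertial_sq_le {α β : ℝ} (hα : 0 ≤ α) (hβ : 0 ≤ β) {a b c : H}
    (hac : inner ℝ a c ≤ 0) :
    ‖a + (α * (1 + β)) • b + β • c‖ ^ 2
      ≤ (1 + α) * (‖a‖ ^ 2 + α * (1 + β) ^ 2 * ‖b‖ ^ 2 + β ^ 2 * ‖c‖ ^ 2) := by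
  -- Grouping a with c uses the sign of ⟨a, c⟩; the rest is ‖e + αf‖² ≤ (1 + α)(‖e‖² + α‖f‖²).
  set e := a + β • c with he
  set f := (1 + β) • b with hf
  have h1 : ‖e‖ ^ 2 ≤ ‖a‖ ^ 2 + β ^ 2 * ‖c‖ ^ 2 := by
    rw [he, norm_add_sq_real, real_inner_smul_right, norm_smul, mul_pow, Real.norm_eq_abs, sq_abs]
    nlinarith [mul_nonpos_of_nonneg_of_nonpos hβ hac]
  have h2 : ‖f‖ ^ 2 = (1 + β) ^ 2 * ‖b‖ ^ 2 := by
    rw [hf, norm_smul, mul_pow, Real.norm_eq_abs, sq_abs]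
  have h3 : a + (α * (1 + β)) • b + β • c = e + α • f := by
    rw [he, hf, smul_smul]; abel
  have h4 : ‖e + α • f‖ ^ 2 = ‖e‖ ^ 2 + 2 * α * inner ℝ e f + α ^ 2 * ‖f‖ ^ 2 := by
    rw [norm_add_sq_real, real_inner_smul_right, norm_smul, mul_pow, Real.norm_eq_abs, sq_abs]
    ring
  have h5 := norm_sub_sq_real e f
  have h6 : 2 * inner ℝ e f ≤ ‖e‖ ^ 2 + ‖f‖ ^ 2 := by nlinarith [sq_nonneg ‖e - f‖]
  have h7 := mul_le_mul_of_nonneg_left h6 hα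
  have h8 := mul_le_mul_of_nonneg_left h1 (show 0 ≤ 1 + α by linarith)
  rw [h3, h4, mul_assoc α, ← h2]
  nlinarith

/-- A bounded family in a Hilbert space has a weak limit along every ultrafilter. -/
theorem exists_weak_limit [CompleteSpace H] {ι : Type*} (U : Ultrafilter ι) {x : ι → H} {R : ℝ}
    (hR : ∀ i, ‖x i‖ ≤ R) :
    ∃ p : H, ∀ z : H, Tendsto (fun i => inner ℝ (x i) z) U (𝓝 (inner ℝ p z)) := by
  let φ : ι → WeakDual ℝ H := fun i => StrongDual.toWeakDual (InnerProductSpace.toDual ℝ H (x i))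
  have hmem : ∀ i, φ i ∈ WeakDual.toStrongDual ⁻¹' Metric.closedBall (0 : StrongDual ℝ H) R := by
    intro i
    simpa [φ] using hR i
  -- Banach–Alaoglu in the dual, transported back by the Riesz representation.
  obtain ⟨ψ, -, hψ⟩ := (WeakDual.isCompact_closedBall (0 : StrongDual ℝ H) R).ultrafilter_le_nhds
    (U.map φ) (le_principal_iff.2 (mem_map.2 (Eventually.of_forall hmem)))
  refine ⟨(InnerProductSpace.toDual ℝ H).symm (WeakDual.toStrongDual ψ), fun z => ?_⟩
  rw [InnerProductSpace.toDual_symm_apply]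
  exact ((WeakDual.eval_continuous z).tendsto ψ).comp (show Tendsto φ U (𝓝 ψ) from hψ)

/-- If every weak limit of `x` lies in `S` and `x` stays in the ball around `x0` that reaches the
projection `p` of `x0` onto `S`, then `x` converges strongly to `p`. -/
theorem tendsto_isProj_of_weak_limits [CompleteSpace H] {S : Set H} {x0 p : H} (hp : IsProj S x0 p)
    {x : ℕ → H} (hx : ∀ k, ‖x k - x0‖ ≤ ‖p - x0‖)
    (hweak : ∀ (U : Ultrafilter ℕ) (q : H), (U : Filter ℕ) ≤ atTop →
      (∀ z : H, Tendsto (fun i => inner ℝ (x i) z) U (𝓝 (inner ℝ q z))) → q ∈ S) :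
    Tendsto x atTop (𝓝 p) := by
  rw [tendsto_iff_ultrafilter]
  intro U hU
  obtain ⟨q, hq⟩ := exists_weak_limit U (x := x) (R := ‖p - x0‖ + ‖x0‖) fun i => by
    have := norm_add_le (x i - x0) x0
    rw [sub_add_cancel] at this
    linarith [hx i]
  have hqS := hweak U q hU hq
  have hq' : ∀ z : H, Tendsto (fun i => inner ℝ (x i - x0) z) U (𝓝 (inner ℝ (q - x0) z)) := by
    intro z
    simp only [inner_sub_left]
    exact (hq z).sub_const _
  -- Weak lower semicontinuity of the norm, by testing against q - x0.
  have hqd : ‖q - x0‖ ≤ ‖p - x0‖ := by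
    have h := le_of_tendsto (hq' (q - x0)) (Eventually.of_forall fun i =>
      (real_inner_le_norm _ _).trans (mul_le_mul_of_nonneg_right (hx i) (norm_nonneg _)))
    rw [real_inner_self_eq_norm_mul_norm] at h
    by_contra! hlt
    nlinarith [norm_nonneg (p - x0)]
  have hqp : q = p := (hp q).1 ⟨hqS, fun z hz => hqd.trans (hp.norm_le hz)⟩
  subst hqp
  have hlim : Tendsto (fun i => 2 * ‖q - x0‖ ^ 2 - 2 * inner ℝ (x i - x0) (q - x0)) U (𝓝 0) := by
    have := ((hq' (q - x0)).const_mul 2).const_sub (2 * ‖q - x0‖ ^ 2)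
    rwa [real_inner_self_eq_norm_sq, sub_self] at this
  have hsq : Tendsto (fun i => ‖x i - q‖ ^ 2) U (𝓝 0) := by
    refine squeeze_zero (fun i => by positivity) (fun i => ?_) hlim
    have e : x i - q = (x i - x0) - (q - x0) := by abel
    rw [e, norm_sub_sq_real (x i - x0)]
    nlinarith [pow_le_pow_left₀ (norm_nonneg _) (hx i) 2]
  rw [tendsto_iff_norm_sub_tendsto_zero]
  have := hsq.sqrt
  simpa only [Real.sqrt_sq (norm_nonneg _), Real.sqrt_zero] using this

/-! ### Estimates along a run. -/

section Run

variable {F : H → H} {D C : Set H} {B : H → Set H} {L σ lam : ℝ} {α β : ℕ → ℝ} {x0 : H}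
  {x w wt wp y v : ℕ → H}

theorem IsTsengRun.residual_mem (hr : IsTsengRun F B C lam α β x0 x w wt wp y v)
    (hlam : 0 < lam) (hBC : opDom B ⊆ C) (hCD : C ⊆ D) (k : ℕ) :
    v k ∈ opAdd (ofMap F D) B (y k) :=
  (residual_mem_opAdd hBC hCD hlam (hr.y_eq k) (hr.v_eq k)).2

/-- W_0 is the whole space, and the variational inequality for the projection `x (k+1)` is exactly
the inclusion of S in W_(k+1). -/
theorem IsTsengRun.inner_le_zero_of_mem_solSet
    (hr : IsTsengRun F B C lam α β x0 x w wt wp y v) (hlam : 0 < lam)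
    (hFmono : ∀ x ∈ D, ∀ y ∈ D, 0 ≤ inner ℝ (x - y) (F x - F y)) (hB : IsMonotoneOp B)
    (hBC : opDom B ⊆ C) (hCD : C ⊆ D) {z : H} (hz : z ∈ solSet F D B) (k : ℕ) :
    inner ℝ (z - x k) (x0 - x k) ≤ 0 := by
  induction k with
  | zero => simp [hr.init]
  | succ k ih =>
    exact (hr.x_succ k).inner_le
      ((convex_setOf_inner_sub_le _ _).inter (convex_setOf_inner_sub_le _ _))
      ⟨inner_sub_residual_le_zero hFmono hB hz (hr.residual_mem hlam hBC hCD k), ih⟩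

theorem IsTsengRun.norm_sub_le_of_mem_solSet
    (hr : IsTsengRun F B C lam α β x0 x w wt wp y v) (hlam : 0 < lam)
    (hFmono : ∀ x ∈ D, ∀ y ∈ D, 0 ≤ inner ℝ (x - y) (F x - F y)) (hB : IsMonotoneOp B)
    (hBC : opDom B ⊆ C) (hCD : C ⊆ D) {z : H} (hz : z ∈ solSet F D B) (k : ℕ) :
    ‖x k - x0‖ ≤ ‖z - x0‖ := by
  have h := hr.inner_le_zero_of_mem_solSet hlam hFmono hB hBC hCD hz k
  refine le_of_sq_le_sq ?_ (norm_nonneg _)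
  have e : z - x0 = (z - x k) - (x0 - x k) := by abel
  rw [e, norm_sub_sq_real (z - x k), norm_sub_rev (x k)]
  nlinarith [sq_nonneg ‖z - x k‖]

/-- `x (k+1)` lies in W_k, so the angle at `x k` between `x0` and `x (k+1)` is not acute.
Telescoping this gives square-summable steps. -/
theorem IsTsengRun.norm_sq_add_le (hr : IsTsengRun F B C lam α β x0 x w wt wp y v) (k : ℕ) :
    ‖x k - x0‖ ^ 2 + ‖x (k + 1) - x k‖ ^ 2 ≤ ‖x (k + 1) - x0‖ ^ 2 := by
  have h : inner ℝ (x (k + 1) - x k) (x0 - x k) ≤ 0 := (hr.x_succ k).mem.2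
  have e : x (k + 1) - x0 = (x (k + 1) - x k) - (x0 - x k) := by abel
  rw [e, norm_sub_sq_real (x (k + 1) - x k), norm_sub_rev (x k)]
  linarith

theorem IsTsengRun.sum_norm_sq_le (hr : IsTsengRun F B C lam α β x0 x w wt wp y v) (n : ℕ) :
    ∑ i ∈ Finset.range n, ‖x (i + 1) - x i‖ ^ 2 ≤ ‖x n - x0‖ ^ 2 := by
  induction n with
  | zero => simp
  | succ n ih => rw [Finset.sum_range_succ]; linarith [hr.norm_sq_add_le n]

/-- Bound for the sum of the squared distances between the extrapolated points and the next
iterates. -/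
theorem IsTsengRun.sum_norm_sub_succ_sq_le (hr : IsTsengRun F B C lam α β x0 x w wt wp y v)
    {d a b : ℝ} (hd : ∀ k, ‖x k - x0‖ ≤ d) (hα : ∀ k, 0 ≤ α k) (hαa : ∀ k, α k ≤ a)
    (hβ : ∀ k, 0 ≤ β k) (hβb : ∀ k, β k ≤ b) (hβsum : Summable fun k => β k ^ 2) (n : ℕ) :
    ∑ i ∈ Finset.range n, ‖wt i - x (i + 1)‖ ^ 2
      ≤ d ^ 2 * ((1 + a) * (1 + a * (1 + b) ^ 2 + ∑' i, β i ^ 2)) := by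
  have ha : 0 ≤ a := (hα 0).trans (hαa 0)
  have hb : 0 ≤ b := (hβ 0).trans (hβb 0)
  have hd2 : ∀ k, ‖x k - x0‖ ^ 2 ≤ d ^ 2 := fun k => pow_le_pow_left₀ (norm_nonneg _) (hd k) 2
  have hterm : ∀ i, ‖wt i - x (i + 1)‖ ^ 2 ≤ (1 + a) * (‖x (i + 1) - x i‖ ^ 2
      + a * (1 + b) ^ 2 * ‖x i - x (i - 1)‖ ^ 2 + β i ^ 2 * d ^ 2) := by
    intro i
    have hac : inner ℝ (x i - x (i + 1)) (x i - x0) ≤ 0 := by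
      have h : inner ℝ (x (i + 1) - x i) (x0 - x i) ≤ 0 := (hr.x_succ i).mem.2
      rwa [← inner_neg_neg, neg_sub, neg_sub] at h
    have e : wt i - x (i + 1) = (x i - x (i + 1)) + (α i * (1 + β i)) • (x i - x (i - 1))
        + β i • (x i - x0) := by
      rw [hr.wt_eq, hr.w_eq]
      module
    rw [e]
    refine (norm_inertial_sq_le (hα i) (hβ i) hac).trans ?_
    rw [norm_sub_rev (x i) (x (i + 1))]
    have h1 := hα i
    have h2 := hβ i
    have h3 := hd2 i
    gcongr
    · exact hαa i
    · exact hαa i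
    · exact hβb i
  have hsum1 : ∑ i ∈ Finset.range n, ‖x (i + 1) - x i‖ ^ 2 ≤ d ^ 2 :=
    (hr.sum_norm_sq_le n).trans (hd2 n)
  have hsum2 : ∑ i ∈ Finset.range n, ‖x i - x (i - 1)‖ ^ 2 ≤ d ^ 2 := by
    cases n with
    | zero => simpa using sq_nonneg d
    -- The term of index 0 vanishes because `0 - 1 = 0`; the others are the steps shifted by one.
    | succ n =>
      rw [Finset.sum_range_succ']
      simpa using (hr.sum_norm_sq_le n).trans (hd2 n)
  have hsum3 : ∑ i ∈ Finset.range n, β i ^ 2 ≤ ∑' i, β i ^ 2 :=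
    hβsum.sum_le_tsum _ fun i _ => sq_nonneg _
  calc _ ≤ ∑ i ∈ Finset.range n, (1 + a) * (‖x (i + 1) - x i‖ ^ 2
      + a * (1 + b) ^ 2 * ‖x i - x (i - 1)‖ ^ 2 + β i ^ 2 * d ^ 2) :=
        Finset.sum_le_sum fun i _ => hterm i
    _ = (1 + a) * (∑ i ∈ Finset.range n, ‖x (i + 1) - x i‖ ^ 2
      + a * (1 + b) ^ 2 * ∑ i ∈ Finset.range n, ‖x i - x (i - 1)‖ ^ 2
      + (∑ i ∈ Finset.range n, β i ^ 2) * d ^ 2) := by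
        rw [← Finset.mul_sum, Finset.sum_add_distrib, Finset.sum_add_distrib, Finset.mul_sum,
          Finset.sum_mul]
    _ ≤ (1 + a) * (d ^ 2 + a * (1 + b) ^ 2 * d ^ 2 + (∑' i, β i ^ 2) * d ^ 2) := by gcongr
    _ = _ := by ring

/-- The residual and the length of a step are controlled by the distance from the extrapolated
point to the next iterate. -/
theorem IsTsengRun.residual_le (hr : IsTsengRun F B C (σ / L) α β x0 x w wt wp y v)
    (hL : 0 < L) (hFlip : ∀ x ∈ D, ∀ y ∈ D, ‖F x - F y‖ ≤ L * ‖x - y‖) (hCconv : Convex ℝ C)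
    (hBC : opDom B ⊆ C) (hCD : C ⊆ D) (hσ : 0 < σ) (hσ1 : σ < 1) (k : ℕ) :
    ‖v k‖ ≤ 2 * L / σ * ‖wt k - x (k + 1)‖ ∧
      (1 - σ ^ 2) * ‖wt k - y k‖ ^ 2 ≤ ‖wt k - x (k + 1)‖ ^ 2 := by
  have hlam : 0 < σ / L := by positivity
  have h := residual_estimate hL hFlip hCconv hBC hCD hσ (hr.wp_eq k) (hr.y_eq k) (hr.v_eq k)
  have hH : inner ℝ (x (k + 1) - y k) (v k) ≤ 0 := (hr.x_succ k).mem.1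
  have e : wt k - y k = (wt k - x (k + 1)) + (x (k + 1) - y k) := by abel
  have hin : inner ℝ (wt k - y k) (v k) ≤ ‖wt k - x (k + 1)‖ * ‖v k‖ := by
    rw [e, inner_add_left]
    linarith [real_inner_le_norm (wt k - x (k + 1)) (v k)]
  set t := σ / L with ht
  have hmain : t ^ 2 * ‖v k‖ ^ 2 + (1 - σ ^ 2) * ‖wt k - y k‖ ^ 2
      ≤ 2 * t * (‖wt k - x (k + 1)‖ * ‖v k‖) :=
    h.trans (mul_le_mul_of_nonneg_left hin (by positivity))
  have hpos : 0 ≤ (1 - σ ^ 2) * ‖wt k - y k‖ ^ 2 :=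
    mul_nonneg (by nlinarith) (sq_nonneg _)
  constructor
  · have h1 : 2 * L / σ * ‖wt k - x (k + 1)‖ = 2 * ‖wt k - x (k + 1)‖ / t := by
      rw [ht]; field_simp
    rw [h1, le_div_iff₀ hlam]
    rcases (norm_nonneg (v k)).eq_or_lt with h0 | h0
    · rw [← h0, zero_mul]; positivity
    · have h2 : t * ‖v k‖ * (‖v k‖ * t) ≤ t * ‖v k‖ * (2 * ‖wt k - x (k + 1)‖) := by nlinarith
      exact le_of_mul_le_mul_left h2 (by positivity)
  -- Completing the square: 2t‖v‖‖e‖ - t²‖v‖² ≤ ‖e‖².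
  · nlinarith [sq_nonneg (t * ‖v k‖ - ‖wt k - x (k + 1)‖)]

end Run

/-! ### Convergence and rate. -/

theorem tendsto_zero_of_sum_sq_le {E : Type*} [NormedAddCommGroup E] {u : ℕ → E} {M : ℝ}
    (h : ∀ n, ∑ i ∈ Finset.range n, ‖u i‖ ^ 2 ≤ M) : Tendsto u atTop (𝓝 0) := by
  have hs := (summable_of_sum_range_le (fun i => sq_nonneg ‖u i‖) h).tendsto_atTop_zero
  rw [tendsto_zero_iff_norm_tendsto_zero]
  simpa only [Real.sqrt_sq (norm_nonneg _), Real.sqrt_zero] using hs.sqrt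

/-- The smallest of `k + 1` numbers is at most their root mean square. -/
theorem exists_le_of_sum_sq_le {e : ℕ → ℝ} {M : ℝ} (k : ℕ)
    (h : ∑ i ∈ Finset.range (k + 1), e i ^ 2 ≤ M) : ∃ j ≤ k, e j ≤ √M / √((k : ℝ) + 1) := by
  obtain ⟨j, hj, hle⟩ := Finset.exists_le_of_sum_le (s := Finset.range (k + 1))
    (f := fun i => e i ^ 2) (g := fun _ => M / ((k : ℝ) + 1)) ⟨0, by simp⟩ (by
      rw [Finset.sum_const, Finset.card_range, nsmul_eq_mul]
      push_cast
      rwa [mul_div_cancel₀ _ (by positivity)])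
  refine ⟨j, Nat.lt_succ_iff.1 (Finset.mem_range.1 hj), ?_⟩
  rw [← Real.sqrt_div' _ (by positivity)]
  exact Real.le_sqrt_of_sq_le hle

/-- If the residuals tend to zero, weak limits of the points are solutions. -/
theorem weak_limit_mem_solSet [CompleteSpace H] {F : H → H} {D C : Set H} {B : H → Set H} {L : ℝ}
    (hFmono : ∀ x ∈ D, ∀ y ∈ D, 0 ≤ inner ℝ (x - y) (F x - F y))
    (hL : 0 < L) (hFlip : ∀ x ∈ D, ∀ y ∈ D, ‖F x - F y‖ ≤ L * ‖x - y‖)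
    (hB : IsMaximalMonotoneOp B) (hCcl : IsClosed C) (hBC : opDom B ⊆ C) (hCD : C ⊆ D)
    (hne : ∃ x u, u ∈ B x) {l : Filter ℕ} [l.NeBot] {x y v : ℕ → H} {q : H} {R : ℝ}
    (hR : ∀ k, ‖x k‖ ≤ R) (hv : ∀ k, v k ∈ opAdd (ofMap F D) B (y k))
    (hv0 : Tendsto v l (𝓝 0)) (hyx : Tendsto (fun k => y k - x k) l (𝓝 0))
    (hq : ∀ z : H, Tendsto (fun i => inner ℝ (x i) z) l (𝓝 (inner ℝ q z))) :
    q ∈ solSet F D B := by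
  rw [mem_solSet_iff hFmono hL hFlip hB hCcl hBC hCD hne]
  intro z u hu
  have hxv : Tendsto (fun k => inner ℝ (x k) (v k)) l (𝓝 0) := by
    refine squeeze_zero_norm (a := fun k => R * ‖v k‖) (fun k => ?_) (by
      simpa using hv0.norm.const_mul R)
    exact (norm_inner_le_norm _ _).trans (mul_le_mul_of_nonneg_right (hR k) (norm_nonneg _))
  have hyv : Tendsto (fun k => inner ℝ (y k - x k - z) (v k)) l (𝓝 0) := by
    simpa using (hyx.sub_const z).inner (𝕜 := ℝ) hv0
  have hyu : Tendsto (fun k => inner ℝ (y k - x k - z) u) l (𝓝 (inner ℝ (0 - z) u)) :=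
    (hyx.sub_const z).inner tendsto_const_nhds
  -- Writing y - z = x + (y - x - z) splits the monotonicity inequality into bounded-times-null
  -- terms, a weakly convergent one and a strongly convergent one.
  have hlim := (hxv.add hyv).sub ((hq u).add hyu)
  have h := ge_of_tendsto hlim (b := 0) (Eventually.of_forall fun k => by
    have h := isMonotoneOp_opAdd_ofMap hFmono hB.1 _ _ _ (hv k) _ hu
    simp only [inner_sub_left, inner_sub_right] at h ⊢
    linarith)
  simp only [inner_sub_left, inner_zero_left] at h ⊢
  linarith

/-- Strong convergence of the method. -/
theorem IsTsengRun.tendsto [CompleteSpace H] {F : H → H} {D C : Set H} {B : H → Set H}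
    {L σ : ℝ} {α β : ℕ → ℝ} {x0 xs : H} {x w wt wp y v : ℕ → H}
    (hr : IsTsengRun F B C (σ / L) α β x0 x w wt wp y v)
    (hFmono : ∀ x ∈ D, ∀ y ∈ D, 0 ≤ inner ℝ (x - y) (F x - F y))
    (hL : 0 < L) (hFlip : ∀ x ∈ D, ∀ y ∈ D, ‖F x - F y‖ ≤ L * ‖x - y‖)
    (hB : IsMaximalMonotoneOp B) (hCcl : IsClosed C) (hCconv : Convex ℝ C)
    (hBC : opDom B ⊆ C) (hCD : C ⊆ D) (hne : ∃ x u, u ∈ B x) (hσ : 0 < σ) (hσ1 : σ < 1)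
    (hxs : IsProj (solSet F D B) x0 xs) {M : ℝ}
    (hM : ∀ n, ∑ i ∈ Finset.range n, ‖wt i - x (i + 1)‖ ^ 2 ≤ M) :
    Tendsto x atTop (𝓝 xs) ∧ Tendsto y atTop (𝓝 xs) := by
  have hlam : 0 < σ / L := by positivity
  have hd := hr.norm_sub_le_of_mem_solSet hlam hFmono hB.1 hBC hCD hxs.mem
  have hres := hr.residual_le hL hFlip hCconv hBC hCD hσ hσ1
  have he : Tendsto (fun k => wt k - x (k + 1)) atTop (𝓝 0) := tendsto_zero_of_sum_sq_le hM
  have hv0 : Tendsto v atTop (𝓝 0) :=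
    squeeze_zero_norm (fun k => (hres k).1) (by simpa using he.norm.const_mul (2 * L / σ))
  have hσ2 : 0 < 1 - σ ^ 2 := by nlinarith
  have hwy : Tendsto (fun k => wt k - y k) atTop (𝓝 0) := by
    refine tendsto_zero_of_sum_sq_le (M := M / (1 - σ ^ 2)) fun n => ?_
    rw [le_div_iff₀' hσ2, Finset.mul_sum]
    exact (Finset.sum_le_sum fun i _ => (hres i).2).trans (hM n)
  have hxx : Tendsto (fun k => x (k + 1) - x k) atTop (𝓝 0) :=
    tendsto_zero_of_sum_sq_le (M := ‖xs - x0‖ ^ 2) fun n =>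
      (hr.sum_norm_sq_le n).trans (pow_le_pow_left₀ (norm_nonneg _) (hd n) 2)
  have hyx : Tendsto (fun k => y k - x k) atTop (𝓝 0) := by
    have := (he.sub hwy).add hxx
    simp only [sub_zero, add_zero] at this
    refine this.congr fun k => ?_
    abel
  have hx : Tendsto x atTop (𝓝 xs) := by
    refine tendsto_isProj_of_weak_limits hxs hd fun U q hU hq => ?_
    refine weak_limit_mem_solSet (R := ‖xs - x0‖ + ‖x0‖) hFmono hL hFlip hB hCcl hBC hCD hne
      (fun k => ?_) (hr.residual_mem hlam hBC hCD) (hv0.mono_left hU) (hyx.mono_left hU) hq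
    have := norm_add_le (x k - x0) x0
    rw [sub_add_cancel] at this
    linarith [hd k]
  refine ⟨hx, ?_⟩
  simpa using hyx.add hx

end InertialTseng

open InertialTseng

theorem theorem5p1 {H : Type*} [NormedAddCommGroup H] [InnerProductSpace ℝ H] [CompleteSpace H]
    (F : H → H) (D C : Set H) (B : H → Set H) (L σ : ℝ) (α β : ℕ → ℝ) (x0 : H)
    (hFcont : ContinuousOn F D)
    (hFmono : ∀ x ∈ D, ∀ y ∈ D, 0 ≤ inner ℝ (x - y) (F x - F y))
    (hL : 0 < L) (hFlip : ∀ x ∈ D, ∀ y ∈ D, ‖F x - F y‖ ≤ L * ‖x - y‖)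
    (hB : IsMaximalMonotoneOp B)
    (hCne : C.Nonempty) (hCcl : IsClosed C) (hCconv : Convex ℝ C)
    (hBC : opDom B ⊆ C) (hCD : C ⊆ D)
    (hS : (solSet F D B).Nonempty)
    (hσ0 : 0 < σ) (hσ1 : σ < 1)
    (hα : ∀ k, 0 ≤ α k) (hαbdd : BddAbove (Set.range α))
    (hβ : ∀ k, 0 ≤ β k) (hβsum : Summable fun k => β k ^ 2) :
    -- the projection of `x0` onto the solution set and the iterations are well defined
    ∃ xs, IsProj (solSet F D B) x0 xs ∧
      (∃ x w wt wp y v : ℕ → H, IsTsengRun F B C (σ / L) α β x0 x w wt wp y v) ∧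
      ∀ x w wt wp y v : ℕ → H, IsTsengRun F B C (σ / L) α β x0 x w wt wp y v →
        Filter.Tendsto x Filter.atTop (nhds xs) ∧
        Filter.Tendsto y Filter.atTop (nhds xs) ∧
        ∀ k : ℕ, ∃ j ≤ k,
          v j ∈ opAdd (ofMap F D) B (y j) ∧
          ‖v j‖ ≤ 2 * Metric.infDist x0 (solSet F D B) * L / √((k : ℝ) + 1) *
            (√((1 + ⨆ i, α i) *
                ((1 + ⨆ i, β i) * (1 + (⨆ i, α i) * (1 + ⨆ i, β i)) + ∑' i, β i ^ 2)) /
              ((1 - σ ^ 2) * σ)) := by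
  have hlam : 0 < σ / L := by positivity
  have hne : ∃ x u, u ∈ B x := by
    obtain ⟨z, hz⟩ := hS
    exact ⟨z, _, (mem_opAdd_ofMap.1 (mem_solSet.1 hz)).2⟩
  obtain ⟨hScl, hSconv⟩ := isClosed_and_convex_solSet hFmono hL hFlip hB hCcl hBC hCD hne
  obtain ⟨xs, hxs⟩ := exists_isProj hS hScl hSconv x0
  refine ⟨xs, hxs, exists_isTsengRun hFmono hB hCne hCcl hCconv hBC hCD hne hS hlam α β x0, ?_⟩
  intro x w wt wp y v hr
  have hαa : ∀ k, α k ≤ ⨆ i, α i := fun k => le_ciSup hαbdd k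
  -- Square summability bounds β, so its `⨆` is a true supremum and not the default value 0.
  have hβbdd : BddAbove (Set.range β) := ⟨√(∑' i, β i ^ 2), by
    rintro _ ⟨k, rfl⟩
    exact Real.le_sqrt_of_sq_le (hβsum.le_tsum k fun i _ => sq_nonneg _)⟩
  have hβb : ∀ k, β k ≤ ⨆ i, β i := fun k => le_ciSup hβbdd k
  rw [hxs.infDist_eq]
  set a := ⨆ i, α i
  set b := ⨆ i, β i
  have ha : 0 ≤ a := (hα 0).trans (hαa 0)
  have hb : 0 ≤ b := (hβ 0).trans (hβb 0)
  set s := ∑' i, β i ^ 2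
  set d := ‖xs - x0‖
  have hs : 0 ≤ s := tsum_nonneg fun i => sq_nonneg _
  have hd0 : 0 ≤ d := norm_nonneg _
  have hd := hr.norm_sub_le_of_mem_solSet hlam hFmono hB.1 hBC hCD hxs.mem
  have hM : ∀ n, ∑ i ∈ Finset.range n, ‖wt i - x (i + 1)‖ ^ 2
      ≤ d ^ 2 * ((1 + a) * ((1 + b) * (1 + a * (1 + b)) + s)) := fun n => by
    refine (hr.sum_norm_sub_succ_sq_le hd hα hαa hβ hβb hβsum n).trans ?_
    gcongr
    -- The stated constant exceeds the proved one, 1 + a(1+b)² + s, by b.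
    nlinarith
  obtain ⟨hx, hy⟩ := hr.tendsto hFmono hL hFlip hB hCcl hCconv hBC hCD hne hσ0 hσ1 hxs hM
  refine ⟨hx, hy, fun k => ?_⟩
  obtain ⟨j, hjk, hj⟩ := exists_le_of_sum_sq_le k (hM (k + 1))
  refine ⟨j, hjk, hr.residual_mem hlam hBC hCD j, ?_⟩
  rw [Real.sqrt_mul (sq_nonneg d), Real.sqrt_sq hd0] at hj
  set K := √((1 + a) * ((1 + b) * (1 + a * (1 + b)) + s))
  have hσ2 : 0 < 1 - σ ^ 2 := by nlinarith
  have hσ3 : 1 - σ ^ 2 ≤ 1 := by nlinarith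
  have hK : 0 ≤ K := Real.sqrt_nonneg _
  calc ‖v j‖ ≤ 2 * L / σ * ‖wt j - x (j + 1)‖ :=
        (hr.residual_le hL hFlip hCconv hBC hCD hσ0 hσ1 j).1
    _ ≤ 2 * L / σ * (d * K / √((k : ℝ) + 1)) := by gcongr
    _ = 2 * d * L / √((k : ℝ) + 1) * (K / (1 * σ)) := by field_simp
    -- The factor 1 - σ² ≤ 1 in the denominator is pure slack: the residual bound holds without it.
    _ ≤ 2 * d * L / √((k : ℝ) + 1) * (K / ((1 - σ ^ 2) * σ)) := by gcongr
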